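/- For a norm $\|\cdot\|$ on $\mathbb R^d$, a set $\Theta\subset\mathbb R^d$ is called permeable if for all $x,y\in\mathbb R^d$ and all $\delta>0$ there is a path (continuous map) $\gamma\colon[a,b]\to\mathbb R^d$, $a<b$, with $\gamma(a)=x$, $\gamma(b)=y$, of length (the supremum of $\sum_k\|\gamma(t_k)-\gamma(t_{k-1})\|$ over all partitions of $[a,b]$) at most $\|y-x\|+\delta$, such that the closure of $\gamma([a,b])\cap\Theta$ is countable; $\Theta$ is impermeable if it is not permeable. Unless another norm is named, the norm is the Euclidean one. **Theorem.** For each $d\ge 1$ there exists an impermeable set in $\mathbb R^d$ which is compact, has Lebesgue measure $0$ and topological dimension $0$. More precisely, the following set $K_d$ has all these properties, and it is also impermeable with respect to the $1$-norm on $\mathbb R^d$. For $d=1$, $K_1$ is the middle third Cantor set. For $d\ge 2$ let $$R=\{(2i,j)\colon 0\le i<24,\ 0\le j<10,\ j\not\equiv 5i+7 \pmod{10}\},$$ $$T(y_1,\dots,y_d)=\Big(\frac{y_1}{48},\frac{y_2}{10},\dots,\frac{y_d}{10}\Big),$$ $$P_k(y_1,\dots,y_d)=\big(y_1,\,y_{2+(k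 \bmod (d-1))},\,y_{2+((k+1)\bmod (d-1))},\,\dots,\,y_{2+((k+d-2)\bmod (d-1))}\big),$$ and $$K_d=\Big\{\sum_{k=1}^\infty T^kP_kx_k\colon x_1,x_2,\ldots\in R\times\{0,\dots,9\}^{d-2}\Big\}.$$ In particular, $K_2=\{\sum_{k\ge1}T^kx_k\colon x_1,x_2,\ldots\in R\}$ is the Bedford–McMullen carpet of the $48\times10$-pattern $R$. -/

import Mathlib

/-- `Θ` is permeable in the normed space `E`: any two points `x`, `y` can, for every `δ > 0`, be
joined by a path `γ : [a, b] → E` of length at most `‖y - x‖ + δ` such that the closure of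
`γ([a, b]) ∩ Θ` is countable. The length of `γ` is its total variation `eVariationOn`. -/
def Permeable {E : Type*} [NormedAddCommGroup E] (Θ : Set E) : Prop :=
  ∀ x y : E, ∀ δ : ℝ, 0 < δ →
    ∃ (a b : ℝ) (γ : ℝ → E), a < b ∧ ContinuousOn γ (Set.Icc a b) ∧ γ a = x ∧ γ b = y ∧
      eVariationOn γ (Set.Icc a b) ≤ ENNReal.ofReal (‖y - x‖ + δ) ∧
      (closure (γ '' Set.Icc a b ∩ Θ)).Countable

/-- A set is impermeable if it is not permeable. -/
def Impermeable {E : Type*} [NormedAddCommGroup E] (Θ : Set E) : Prop :=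
  ¬ Permeable Θ

/-- The same subset of `ℝ^d`, regarded as a subset of `ℝ^d` with the norm `‖x‖₁ = ∑ i, |x i|`. -/
def inOneNorm {d : ℕ} (Θ : Set (EuclideanSpace ℝ (Fin d))) :
    Set (PiLp 1 (fun _ : Fin d => ℝ)) :=
  {x | WithLp.toLp 2 (fun i => x i) ∈ Θ}

/-- The contraction dividing the first coordinate by `n` and all other coordinates by `m`. -/
noncomputable def gridContraction (n m : ℕ) {e : ℕ} (y : EuclideanSpace ℝ (Fin (e + 1))) :
    EuclideanSpace ℝ (Fin (e + 1)) :=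
  WithLp.toLp 2 (Fin.cons (y 0 / (n : ℝ)) (fun q : Fin e => y q.succ / (m : ℝ)))

/-- The Bedford-McMullen carpet `K_R = {∑_{k ≥ 1} T^k x_k : x_1, x_2, … ∈ R}` of an `n × m`-pattern
`R`, where `T (x, y) = (x / n, y / m)`. The sequence `x` is indexed from `0`. -/
def bedfordMcMullenCarpet (n m : ℕ) (R : Set (ℕ × ℕ)) : Set (EuclideanSpace ℝ (Fin 2)) :=
  {z | ∃ x : ℕ → ℕ × ℕ, (∀ k, x k ∈ R) ∧
    HasSum (fun k => (gridContraction n m)^[k + 1] !₂[((x k).1 : ℝ), ((x k).2 : ℝ)]) z}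

/-- The `48 × 10`-pattern `{(2i, j) : 0 ≤ i < 24, 0 ≤ j < 10, j ≢ 5i + 7 mod 10}`. -/
def pattern48x10 : Set (ℕ × ℕ) :=
  {r | ∃ i j : ℕ, i < 24 ∧ j < 10 ∧ ¬ j ≡ 5 * i + 7 [MOD 10] ∧ r = (2 * i, j)}

/-- The digit vectors `R × {0, …, 9}^{d - 2}` for `d = e + 2`, with `R` the `48 × 10`-pattern. -/
def digitVectors (e : ℕ) : Set (Fin (e + 2) → ℕ) :=
  {v | (v 0, v 1) ∈ pattern48x10 ∧ ∀ p : Fin (e + 2), 2 ≤ p.val → v p < 10}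

/-- `P_k` on `ℝ^d`, `d = e + 2`: it keeps the first coordinate and cyclically shifts the other
`d - 1` coordinates by `k` places,
`P_k y = (y_1, y_{2 + (k mod (d-1))}, …, y_{2 + ((k + d - 2) mod (d-1))})`. -/
def cyclicShift (k : ℕ) {e : ℕ} (y : EuclideanSpace ℝ (Fin (e + 2))) :
    EuclideanSpace ℝ (Fin (e + 2)) :=
  WithLp.toLp 2 (Fin.cons (y 0) (fun q : Fin (e + 1) => y (Fin.ofNat (e + 1) (k + q.val)).succ))

/-- The set `K_d = {∑_{k ≥ 1} T^k (P_k x_k) : x_1, x_2, … ∈ R × {0, …, 9}^{d - 2}}` in `ℝ^d`,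
`d = e + 2`, where `T y = (y_1 / 48, y_2 / 10, …, y_d / 10)`. The sequence `x` is indexed
from `0`. -/
def cyclicCarpet (e : ℕ) : Set (EuclideanSpace ℝ (Fin (e + 2))) :=
  {z | ∃ x : ℕ → Fin (e + 2) → ℕ, (∀ k, x k ∈ digitVectors e) ∧
    HasSum (fun k => (gridContraction 48 10)^[k + 1]
      (cyclicShift (k + 1) (WithLp.toLp 2 (fun p => (x k p : ℝ))))) z}

/-- The example in dimension `d`: the middle third Cantor set for `d = 1`, and `K_d` for `d ≥ 2`
(the value at `d = 0` is irrelevant). -/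
def carpetExample : (d : ℕ) → Set (EuclideanSpace ℝ (Fin d))
  | 0 => ∅
  | 1 => {z | z 0 ∈ cantorSet}
  | e + 2 => cyclicCarpet e

/-!
# A compact null set of dimension zero that is impermeable

For `d = 1` every path from `0` to `1` covers the Cantor set, which is uncountable, compact, null
and totally disconnected.

Let `d ≥ 2`. In base-`48` digits of the first coordinate and base-`10` digits of the others, the
carpet `K_d` consists of the points whose first coordinate has even digits `2 * i_k` only, and whose
`k`-th digit in one other coordinate, the one selected cyclically by `k`, differs from
`5 * i_k + 7` modulo `10`, that is, from `7` for even `i_k` and from `2` for odd `i_k`.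

*Smallness.* The first coordinates form a self-similar null set made of `24` copies scaled by
`1 / 48` (`volume_evenDigitSet`), so the carpet is null, and a connected subset lies over a single
first coordinate. This coordinate determines all `i_k`, and each of the other coordinates then omits
one digit at infinitely many places, so a connected subset is a point
(`isTotallyDisconnected_cyclicCarpet`). A compact totally disconnected space has a basis of clopen
sets, hence dimension `0`.

*Impermeability.* Consider a path from `(0, 1/2, …, 1/2)` to `(1, 1/2, …, 1/2)` whose length is close
to `1`. Both the Euclidean norm and the `1`-norm dominate `24/25 |v_1| + 7/25 |v_q|` for `q ≥ 2`, and
this forces the variation of the other coordinates to be at most `1 / 5`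
(`eVariationOn_transversal_le`). Suppose that, while the path crosses a column of width `48 ^ (-k)`,
its other coordinates have variation at most `10 ^ (-k) / 5`. This is too little to meet both the
digit `2` and the digit `7` at the next place, so for one parity of `i` all `12` subcolumns `2 * i`
are safe from the forbidden digit. At most `10` subcolumns can carry more than a tenth of the allowed
variation, so at least two of the safe ones satisfy the hypothesis at the next level
(`exists_good_column`). This is where `24 / 2 > 10` is used. The resulting binary tree of columns
leads to uncountably many points of the path in the carpet. Uncountability is obtained by a diagonal
argument: the two columns being disjoint, one of them avoids the `k`-th number of a given sequence
(`exists_mem_cyclicCarpet`).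
-/

/-! ### Digit expansions -/

/-- The natural number with base-`b` digits `a 0, …, a (n - 1)`, most significant digit first. -/
def digitPrefix (b : ℕ) (a : ℕ → ℕ) : ℕ → ℕ
  | 0 => 0
  | n + 1 => b * digitPrefix b a n + a n

theorem hasSum_digit_tail {b : ℕ} (hb : 0 < b) {a : ℕ → ℕ} {x : ℝ}
    (h : HasSum (fun k => (a k : ℝ) / (b : ℝ) ^ (k + 1)) x) (n : ℕ) :
    HasSum (fun k => (a (k + n) : ℝ) / (b : ℝ) ^ (k + 1)) ((b : ℝ) ^ n * x - digitPrefix b a n) := by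
  have hb' : (b : ℝ) ≠ 0 := by positivity
  induction n with
  | zero => simpa [digitPrefix] using h
  | succ n ih =>
    have h1 := ((hasSum_nat_add_iff' 1).2 ih).mul_left (b : ℝ)
    have e1 : (b : ℝ) ^ (n + 1) * x - digitPrefix b a (n + 1) = b * ((b : ℝ) ^ n * x -
        digitPrefix b a n - ∑ i ∈ Finset.range 1, (a (i + n) : ℝ) / (b : ℝ) ^ (i + 1)) := by
      simp only [digitPrefix, Finset.sum_range_one, zero_add, pow_one, Nat.cast_add, Nat.cast_mul]
      field_simp
      ring
    rw [e1]
    have e2 : (fun k => (a (k + (n + 1)) : ℝ) / (b : ℝ) ^ (k + 1)) =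
        fun k => b * ((a (k + 1 + n) : ℝ) / (b : ℝ) ^ (k + 1 + 1)) := by
      ext k
      rw [show k + 1 + n = k + (n + 1) by ring]
      field_simp
      ring
    rw [e2]
    exact h1

theorem hasSum_const_digit {b : ℕ} (hb : 2 ≤ b) (c : ℝ) :
    HasSum (fun k : ℕ => c / (b : ℝ) ^ (k + 1)) (c / ((b : ℝ) - 1)) := by
  have hb' : (2 : ℝ) ≤ b := by exact_mod_cast hb
  have h1 : (b : ℝ) - 1 ≠ 0 := by linarith
  have h := (hasSum_geometric_of_lt_one (r := (b : ℝ)⁻¹) (by positivity)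
    (inv_lt_one_of_one_lt₀ (by linarith))).mul_left (c / b)
  have e1 : c / ((b : ℝ) - 1) = c / b * (1 - (b : ℝ)⁻¹)⁻¹ := by
    field_simp
  have e2 : (fun k : ℕ => c / (b : ℝ) ^ (k + 1)) = fun k => c / b * (b : ℝ)⁻¹ ^ k := by
    ext k
    rw [inv_pow]
    field_simp
    ring
  rw [e1, e2]
  exact h

/-- Digits bounded by `c` give a tail of size at most `c / (b - 1)`. -/
theorem digit_tail_bounds {b : ℕ} (hb : 2 ≤ b) {a : ℕ → ℕ} {c : ℕ} (hc : ∀ k, a k ≤ c) {x : ℝ}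
    (h : HasSum (fun k => (a k : ℝ) / (b : ℝ) ^ (k + 1)) x) (n : ℕ) :
    (digitPrefix b a n : ℝ) ≤ (b : ℝ) ^ n * x ∧
      (b : ℝ) ^ n * x ≤ digitPrefix b a n + c / ((b : ℝ) - 1) := by
  have hb' : (2 : ℝ) ≤ b := by exact_mod_cast hb
  have h1 := hasSum_digit_tail (by omega) h n
  have hg := hasSum_const_digit hb c
  constructor
  · have := h1.nonneg (fun k => by positivity)
    linarith
  · have := hasSum_le (fun k => by
      have : (a (k + n) : ℝ) ≤ c := by exact_mod_cast hc _
      show (a (k + n) : ℝ) / (b : ℝ) ^ (k + 1) ≤ (c : ℝ) / (b : ℝ) ^ (k + 1)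
      gcongr) h1 hg
    linarith

/-- If the digits stay below `b - 1`, then the expansion is unique, since the prefixes are the
integer parts of `b ^ n * x`. -/
theorem digits_unique {b : ℕ} (hb : 2 ≤ b) {a a' : ℕ → ℕ} (ha : ∀ k, a k + 2 ≤ b)
    (ha' : ∀ k, a' k + 2 ≤ b) {x : ℝ} (h : HasSum (fun k => (a k : ℝ) / (b : ℝ) ^ (k + 1)) x)
    (h' : HasSum (fun k => (a' k : ℝ) / (b : ℝ) ^ (k + 1)) x) : a = a' := by
  have hb' : (2 : ℝ) ≤ b := by exact_mod_cast hb
  have key : ∀ {d : ℕ → ℕ}, (∀ k, d k + 2 ≤ b) →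
      HasSum (fun k => (d k : ℝ) / (b : ℝ) ^ (k + 1)) x → ∀ n,
      digitPrefix b d n = ⌊(b : ℝ) ^ n * x⌋₊ := by
    intro d hd hs n
    obtain ⟨h1, h2⟩ := digit_tail_bounds hb (c := b - 2) (fun k => by have := hd k; omega) hs n
    symm
    rw [Nat.floor_eq_iff ((Nat.cast_nonneg _).trans h1)]
    refine ⟨h1, h2.trans_lt ?_⟩
    gcongr
    rw [div_lt_one (by linarith), Nat.cast_sub hb]
    norm_num
  ext n
  have e1 := key ha h
  have e2 := key ha' h'
  have h3 : digitPrefix b a (n + 1) = digitPrefix b a' (n + 1) := by rw [e1, e2]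
  have h4 : digitPrefix b a n = digitPrefix b a' n := by rw [e1, e2]
  simpa [digitPrefix, h4] using h3

/-- A number lying strictly between `m / b ^ (k + 1)` and `(m + 1) / b ^ (k + 1)` has `m % b` as its
digit number `k` in every base-`b` expansion. -/
theorem digit_eq_mod {b : ℕ} (hb : 2 ≤ b) {a : ℕ → ℕ} (ha : ∀ k, a k < b) {x : ℝ}
    (h : HasSum (fun k => (a k : ℝ) / (b : ℝ) ^ (k + 1)) x) {k : ℕ} {m : ℤ}
    (h1 : (m : ℝ) < (b : ℝ) ^ (k + 1) * x) (h2 : (b : ℝ) ^ (k + 1) * x < m + 1) :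
    (a k : ℤ) = m % b := by
  have hb' : (2 : ℝ) ≤ b := by exact_mod_cast hb
  obtain ⟨h3, h4⟩ := digit_tail_bounds hb (c := b - 1) (fun k => by have := ha k; omega) h (k + 1)
  rw [Nat.cast_sub (by omega), Nat.cast_one, div_self (by linarith)] at h4
  have h5 : (digitPrefix b a (k + 1) : ℤ) < m + 1 := by exact_mod_cast h3.trans_lt h2
  have h6 : m < (digitPrefix b a (k + 1) : ℤ) + 1 := by exact_mod_cast h1.trans_le h4
  have h7 : m = (b : ℤ) * digitPrefix b a k + a k := by
    have : (digitPrefix b a (k + 1) : ℤ) = (b : ℤ) * digitPrefix b a k + a k := by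
      simp [digitPrefix]
    omega
  rw [h7, Int.mul_add_emod_self_left, Int.emod_eq_of_lt (by positivity) (by exact_mod_cast ha k)]

/-! ### Coordinates of the carpet -/

theorem EuclideanSpace.hasSum_iff {ι α : Type*} [Fintype ι] {f : α → EuclideanSpace ℝ ι}
    {z : EuclideanSpace ℝ ι} : HasSum f z ↔ ∀ i, HasSum (fun k => f k i) (z i) := by
  rw [← (EuclideanSpace.equiv ι ℝ).hasSum', Pi.hasSum]
  rfl

theorem iterate_gridContraction_zero (n m k : ℕ) {e : ℕ} (y : EuclideanSpace ℝ (Fin (e + 1))) :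
    ((gridContraction n m)^[k] y) 0 = y 0 / (n : ℝ) ^ k := by
  induction k with
  | zero => simp
  | succ k ih =>
    rw [Function.iterate_succ_apply']
    simp [gridContraction, ih, pow_succ, div_div]

theorem iterate_gridContraction_succ (n m k : ℕ) {e : ℕ} (y : EuclideanSpace ℝ (Fin (e + 1)))
    (q : Fin e) : ((gridContraction n m)^[k] y) q.succ = y q.succ / (m : ℝ) ^ k := by
  induction k with
  | zero => simp
  | succ k ih =>
    rw [Function.iterate_succ_apply']
    simp [gridContraction, ih, pow_succ, div_div]

theorem mem_cyclicCarpet_iff {e : ℕ} {z : EuclideanSpace ℝ (Fin (e + 2))} :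
    z ∈ cyclicCarpet e ↔ ∃ x : ℕ → Fin (e + 2) → ℕ, (∀ k, x k ∈ digitVectors e) ∧
      HasSum (fun k => (x k 0 : ℝ) / ((48 : ℕ) : ℝ) ^ (k + 1)) (z 0) ∧
      ∀ q : Fin (e + 1), HasSum (fun k =>
        (x k (Fin.ofNat (e + 1) (k + 1 + q.val)).succ : ℝ) / ((10 : ℕ) : ℝ) ^ (k + 1))
        (z q.succ) := by
  unfold cyclicCarpet
  simp only [Set.mem_ofPred_eq, EuclideanSpace.hasSum_iff, Fin.forall_fin_succ (n := e + 1),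
    iterate_gridContraction_zero, iterate_gridContraction_succ]
  rfl

theorem mem_pattern48x10_iff {v : ℕ × ℕ} : v ∈ pattern48x10 ↔
    ∃ i < 24, v.1 = 2 * i ∧ v.2 < 10 ∧ ¬ v.2 ≡ 5 * i + 7 [MOD 10] := by
  constructor
  · rintro ⟨i, j, hi, hj, h, rfl⟩
    exact ⟨i, hi, rfl, hj, h⟩
  · rintro ⟨i, hi, h1, h2, h3⟩
    exact ⟨i, v.2, hi, h2, h3, Prod.ext h1 rfl⟩

theorem digitVectors_lt {e : ℕ} {v : Fin (e + 2) → ℕ} (hv : v ∈ digitVectors e) (p : Fin (e + 1)) :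
    v p.succ < 10 := by
  obtain ⟨i, -, -, h, -⟩ := mem_pattern48x10_iff.1 hv.1
  rcases Nat.eq_zero_or_pos p.val with hp | hp
  · obtain rfl : p = 0 := Fin.ext hp
    exact h
  · exact hv.2 _ (by rw [Fin.val_succ]; omega)

theorem cyclicCarpet_zero_eq :
    cyclicCarpet 0 = bedfordMcMullenCarpet 48 10 pattern48x10 := by
  ext z
  rw [mem_cyclicCarpet_iff]
  unfold bedfordMcMullenCarpet
  simp only [Set.mem_ofPred_eq, EuclideanSpace.hasSum_iff, Fin.forall_fin_succ (n := 1),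
    iterate_gridContraction_zero, iterate_gridContraction_succ]
  have h2 : ∀ k : ℕ, Fin.ofNat 1 (k + 1 + (0 : Fin 1).val) = 0 := fun k => Subsingleton.elim _ _
  constructor
  · rintro ⟨x, hx, h0, h1⟩
    refine ⟨fun k => (x k 0, x k 1), fun k => (hx k).1, h0, fun q => ?_⟩
    obtain rfl : q = 0 := Fin.fin_one_eq_zero q
    have := h1 0
    simp only [h2] at this
    exact this
  · rintro ⟨x, hx, h0, h1⟩
    refine ⟨fun k => ![(x k).1, (x k).2], fun k => ⟨hx k, fun p hp => by omega⟩, h0, fun q => ?_⟩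
    obtain rfl : q = 0 := Fin.fin_one_eq_zero q
    simp only [h2]
    exact h1 0

/-! ### Compactness -/

theorem isCompact_digitSequences (e : ℕ) :
    IsCompact {x : ℕ → Fin (e + 2) → ℕ | ∀ k, x k ∈ digitVectors e} := by
  have hfin : (digitVectors e).Finite := by
    refine (Set.Finite.pi' (t := fun _ : Fin (e + 2) => Set.Iio 48)
      (fun _ => Set.finite_Iio 48)).subset fun v hv p => ?_
    refine Fin.cases ?_ (fun q => ?_) p
    · obtain ⟨i, hi, h, -⟩ := mem_pattern48x10_iff.1 hv.1
      simp only at h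
      simp only [Set.mem_Iio]
      omega
    · have := digitVectors_lt hv q
      simp only [Set.mem_Iio]
      omega
  convert isCompact_univ_pi (fun _ : ℕ => hfin.isCompact) using 1
  ext x
  simp

theorem isCompact_cyclicCarpet (e : ℕ) : IsCompact (cyclicCarpet e) := by
  have hcont : ∀ (b : ℕ) (p : ℕ → Fin (e + 2)), 2 ≤ b →
      (∀ k, ∀ v ∈ digitVectors e, v (p k) ≤ 48) →
      ContinuousOn (fun x : ℕ → Fin (e + 2) → ℕ => ∑' k, (x k (p k) : ℝ) / (b : ℝ) ^ (k + 1))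
        {x | ∀ k, x k ∈ digitVectors e} ∧
      ∀ x ∈ {x : ℕ → Fin (e + 2) → ℕ | ∀ k, x k ∈ digitVectors e},
        Summable fun k => (x k (p k) : ℝ) / (b : ℝ) ^ (k + 1) := by
    intro b p hb hp
    have hu := (hasSum_const_digit hb 48).summable
    have hle : ∀ k, ∀ x ∈ {x : ℕ → Fin (e + 2) → ℕ | ∀ k, x k ∈ digitVectors e},
        ‖(x k (p k) : ℝ) / (b : ℝ) ^ (k + 1)‖ ≤ (48 : ℝ) / (b : ℝ) ^ (k + 1) := by
      intro k x hx
      rw [Real.norm_of_nonneg (by positivity)]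
      have : (x k (p k) : ℝ) ≤ 48 := by exact_mod_cast hp k _ (hx k)
      gcongr
    refine ⟨continuousOn_tsum (fun k => ?_) hu hle, fun x hx =>
      Summable.of_norm_bounded hu fun k => hle k x hx⟩
    exact ((continuous_of_discreteTopology (f := fun n : ℕ => (n : ℝ))).comp
      ((continuous_apply (p k)).comp (continuous_apply k))).continuousOn.div_const _
  have h0 := hcont 48 (fun _ => 0) (by norm_num) (fun k v hv => by
    obtain ⟨i, hi, h, -⟩ := mem_pattern48x10_iff.1 hv.1
    simp only at h
    omega)
  have h1 := fun q : Fin (e + 1) => hcont 10 (fun k => (Fin.ofNat (e + 1) (k + 1 + q.val)).succ)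
    (by norm_num) (fun k v hv => (digitVectors_lt hv _).le.trans (by norm_num))
  have himage : cyclicCarpet e = (fun x : ℕ → Fin (e + 2) → ℕ =>
      (WithLp.toLp 2 (Fin.cons (∑' k, (x k 0 : ℝ) / ((48 : ℕ) : ℝ) ^ (k + 1))
        (fun q : Fin (e + 1) => ∑' k, (x k (Fin.ofNat (e + 1) (k + 1 + q.val)).succ : ℝ) /
          ((10 : ℕ) : ℝ) ^ (k + 1))) : EuclideanSpace ℝ (Fin (e + 2)))) ''
      {x | ∀ k, x k ∈ digitVectors e} := by
    ext z
    rw [mem_cyclicCarpet_iff]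
    constructor
    · rintro ⟨x, hx, hz0, hz1⟩
      refine ⟨x, hx, ?_⟩
      ext p
      refine Fin.cases ?_ (fun q => ?_) p
      · exact hz0.tsum_eq
      · exact (hz1 q).tsum_eq
    · rintro ⟨x, hx, rfl⟩
      exact ⟨x, hx, (h0.2 x hx).hasSum, fun q => ((h1 q).2 x hx).hasSum⟩
  rw [himage]
  refine (isCompact_digitSequences e).image_of_continuousOn
    ((PiLp.continuous_toLp 2 _).comp_continuousOn (continuousOn_pi.2 fun p => ?_))
  refine Fin.cases ?_ (fun q => ?_) p
  · exact h0.1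
  · exact (h1 q).1

/-! ### Null sets and dimension zero -/

open scoped Pointwise in
/-- A bounded set covered by fewer than `b` copies of itself scaled by `1 / b` is null. -/
theorem volume_eq_zero_of_subset_copies {S : Set ℝ} (hS : Bornology.IsBounded S) {b : ℕ}
    (s : Finset ℝ) (hs : s.card < b) (h : S ⊆ ⋃ c ∈ s, (fun y => (c + y) / b) '' S) :
    MeasureTheory.volume S = 0 := by
  have hb : (0 : ℝ) < b := by exact_mod_cast (Nat.zero_le _).trans_lt hs
  have himage : ∀ c : ℝ, MeasureTheory.volume ((fun y => (c + y) / b) '' S) =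
      ENNReal.ofReal (b : ℝ)⁻¹ * MeasureTheory.volume S := by
    intro c
    have e1 : (fun y => (c + y) / b) '' S = (fun y => c / b + y) '' ((b : ℝ)⁻¹ • S) := by
      rw [← Set.image_smul, Set.image_image]
      refine Set.image_congr fun y _ => ?_
      rw [smul_eq_mul]
      field_simp
    rw [e1, Set.image_add_left, MeasureTheory.measure_preimage_add,
      MeasureTheory.Measure.addHaar_smul]
    simp [abs_of_pos hb]
  have hle : MeasureTheory.volume S ≤
      ENNReal.ofReal (s.card * (b : ℝ)⁻¹) * MeasureTheory.volume S := by
    calc MeasureTheory.volume S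
        ≤ MeasureTheory.volume (⋃ c ∈ s, (fun y => (c + y) / b) '' S) :=
          MeasureTheory.measure_mono h
      _ ≤ ∑ c ∈ s, MeasureTheory.volume ((fun y => (c + y) / b) '' S) :=
          MeasureTheory.measure_biUnion_finset_le _ _
      _ = _ := by
          simp only [himage, Finset.sum_const, nsmul_eq_mul]
          rw [ENNReal.ofReal_mul (by positivity), ENNReal.ofReal_natCast, mul_assoc]
  by_contra hne
  have hfin : MeasureTheory.volume S ≠ ⊤ := hS.measure_lt_top.ne
  have hlt : ENNReal.ofReal (s.card * (b : ℝ)⁻¹) < 1 := by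
    rw [← ENNReal.ofReal_one, ENNReal.ofReal_lt_ofReal_iff one_pos, ← div_eq_mul_inv,
      div_lt_one hb]
    exact_mod_cast hs
  have := ENNReal.mul_lt_mul_left hne hfin hlt
  rw [one_mul] at this
  exact absurd hle this.not_ge

theorem IsPreconnected.subsingleton_of_volume_eq_zero {N t : Set ℝ}
    (hN : MeasureTheory.volume N = 0) (ht : t ⊆ N) (h : IsPreconnected t) : t.Subsingleton := by
  have key : ∀ a ∈ t, ∀ b ∈ t, b ≤ a := by
    intro a ha b hb
    have h0 : MeasureTheory.volume (Set.Icc a b) = 0 :=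
      MeasureTheory.measure_mono_null ((h.Icc_subset ha hb).trans ht) hN
    rw [Real.volume_Icc, ENNReal.ofReal_eq_zero] at h0
    linarith
  exact fun a ha b hb => le_antisymm (key b hb a ha) (key a ha b hb)

theorem smallInductiveDimension_eq_zero {X : Type*} [TopologicalSpace X] [T2Space X] {K : Set X}
    (hK : IsCompact K) (hne : K.Nonempty) (hd : IsTotallyDisconnected K) :
    smallInductiveDimension K = 0 := by
  have : CompactSpace K := isCompact_iff_compactSpace.1 hK
  have : TotallyDisconnectedSpace K := totallyDisconnectedSpace_subtype_iff.2 hd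
  have hn : Nonempty K := hne.to_subtype
  refine smallInductiveDimension_eq 0 ?_ ?_
  · exact hasSmallInductiveDimensionLT_one_iff.2 isTopologicalBasis_isClopen
  · rw [hasSmallInductiveDimensionLT_zero_iff]
    exact not_isEmpty_of_nonempty K

theorem EuclideanSpace.volume_eq_zero_of_coord {ι : Type*} [Fintype ι] (i : ι) {N : Set ℝ}
    (hN : MeasureTheory.volume N = 0) {K : Set (EuclideanSpace ℝ ι)} (hK : ∀ z ∈ K, z i ∈ N) :
    MeasureTheory.volume K = 0 := by
  have h1 := MeasureTheory.Measure.QuasiMeasurePreserving.preimage_null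
    (MeasureTheory.Measure.quasiMeasurePreserving_eval
      (fun _ : ι => (MeasureTheory.volume : MeasureTheory.Measure ℝ)) i) hN
  have h2 := (EuclideanSpace.volume_preserving_symm_measurableEquiv_toLp
    ι).quasiMeasurePreserving.preimage_null h1
  exact MeasureTheory.measure_mono_null hK h2

theorem volume_cantorSet : MeasureTheory.volume cantorSet = 0 := by
  refine volume_eq_zero_of_subset_copies (b := 3) isCompact_cantorSet.isBounded {0, 2}
    (Finset.card_le_two.trans_lt (by norm_num)) fun x hx => ?_
  rw [cantorSet_eq_union_halves] at hx
  rcases hx with ⟨y, hy, rfl⟩ | ⟨y, hy, rfl⟩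
  · exact Set.mem_biUnion (x := 0) (by simp) ⟨y, hy, by simp⟩
  · exact Set.mem_biUnion (x := 2) (by simp) ⟨y, hy, by simp⟩

/-- The set of numbers all of whose base-`48` digits are even, the projection of the carpet to the
first coordinate. -/
def evenDigitSet : Set ℝ :=
  {x | ∃ i : ℕ → ℕ, (∀ k, i k < 24) ∧
    HasSum (fun k => ((2 * i k : ℕ) : ℝ) / ((48 : ℕ) : ℝ) ^ (k + 1)) x}

theorem evenDigitSet_subset_Icc : evenDigitSet ⊆ Set.Icc 0 1 := by
  rintro x ⟨i, hi, h⟩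
  have := digit_tail_bounds (c := 47) (by norm_num) (fun k => by have := hi k; omega) h 0
  norm_num [digitPrefix] at this
  exact ⟨this.1, this.2⟩

theorem volume_evenDigitSet : MeasureTheory.volume evenDigitSet = 0 := by
  refine volume_eq_zero_of_subset_copies (b := 48)
    ((Metric.isBounded_Icc 0 1).subset evenDigitSet_subset_Icc)
    ((Finset.range 24).image fun i : ℕ => ((2 * i : ℕ) : ℝ))
    (Finset.card_image_le.trans_lt (by norm_num)) ?_
  rintro x ⟨i, hi, h⟩
  have h1 := hasSum_digit_tail (a := fun k => 2 * i k) (by norm_num) h 1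
  refine Set.mem_biUnion (x := ((2 * i 0 : ℕ) : ℝ))
    (by simpa using hi 0)
    ⟨_, ⟨fun k => i (k + 1), fun k => hi _, h1⟩, ?_⟩
  simp [digitPrefix]

theorem coord_zero_mem_evenDigitSet {e : ℕ} {z : EuclideanSpace ℝ (Fin (e + 2))}
    (hz : z ∈ cyclicCarpet e) : z 0 ∈ evenDigitSet := by
  obtain ⟨x, hx, h0, -⟩ := mem_cyclicCarpet_iff.1 hz
  choose i hi hxi _ using fun k => mem_pattern48x10_iff.1 (hx k).1
  simp only at hxi
  exact ⟨i, hi, by simpa only [hxi] using h0⟩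

/-- Two points of the carpet over the same first coordinate have the same digits there. An interval
between their coordinates with index `q` would contain one of the open intervals of points whose
digit at a late level `k` with `k + 1 + q ≡ 0` is the one the pattern forbids. -/
theorem isTotallyDisconnected_cyclicCarpet (e : ℕ) : IsTotallyDisconnected (cyclicCarpet e) := by
  intro t ht hconn
  have hsub0 : ((fun z : EuclideanSpace ℝ (Fin (e + 2)) => z 0) '' t).Subsingleton := by
    refine IsPreconnected.subsingleton_of_volume_eq_zero volume_evenDigitSet ?_
      (hconn.image _ (by fun_prop))
    rintro _ ⟨z, hz, rfl⟩
    exact coord_zero_mem_evenDigitSet (ht hz)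
  have hle : ∀ z ∈ t, ∀ w ∈ t, ∀ q : Fin (e + 1), w q.succ ≤ z q.succ := by
    intro z hz w hw q
    by_contra! hlt
    obtain ⟨x, hx, hx0, -⟩ := mem_cyclicCarpet_iff.1 (ht hz)
    choose i hi hxi _ using fun k => mem_pattern48x10_iff.1 (hx k).1
    simp only at hxi
    obtain ⟨N, hN⟩ := pow_unbounded_of_one_lt (2 / (w q.succ - z q.succ))
      (by norm_num : (1 : ℝ) < 10)
    obtain ⟨k, hk, hkq⟩ : ∃ k, N ≤ k ∧ Fin.ofNat (e + 1) (k + 1 + q.val) = 0 := by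
      refine ⟨(N + 1) * (e + 1) + (e - q.val), ?_, ?_⟩
      · nlinarith [Nat.zero_le (N * e)]
      · ext
        have := q.isLt
        simp only [Fin.ofNat, Fin.val_zero]
        rw [show (N + 1) * (e + 1) + (e - q.val) + 1 + q.val = (N + 2) * (e + 1) by
          have : e - q.val + q.val = e := by omega
          linarith, Nat.mul_mod_left]
    set m : ℤ := 10 * (⌊(10 : ℝ) ^ k * z q.succ⌋ + 1) + ((5 * i k + 7) % 10 : ℕ) with hm
    have hf : ((5 * i k + 7) % 10 : ℕ) ≤ 9 := by omega
    have hf' : (((5 * i k + 7) % 10 : ℕ) : ℝ) ≤ 9 := by exact_mod_cast hf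
    have hf0 : (0 : ℝ) ≤ (((5 * i k + 7) % 10 : ℕ) : ℝ) := Nat.cast_nonneg _
    have hmr : (m : ℝ) = 10 * ((⌊(10 : ℝ) ^ k * z q.succ⌋ : ℝ) + 1) +
        (((5 * i k + 7) % 10 : ℕ) : ℝ) := by
      rw [hm, Int.cast_add, Int.cast_mul, Int.cast_add, Int.cast_natCast]
      norm_num
    have hfl := Int.floor_le ((10 : ℝ) ^ k * z q.succ)
    have hlf := Int.lt_floor_add_one ((10 : ℝ) ^ k * z q.succ)
    have hp : (0 : ℝ) < 10 ^ k := by positivity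
    have hbig : (10 : ℝ) ^ k * z q.succ + 2 < 10 ^ k * w q.succ := by
      have h1 : 2 / (w q.succ - z q.succ) < (10 : ℝ) ^ k :=
        hN.trans_le (pow_le_pow_right₀ (by norm_num) hk)
      rw [div_lt_iff₀ (by linarith)] at h1
      linarith
    set y : ℝ := (m + 1 / 2) / 10 ^ (k + 1) with hy
    have hy1 : (10 : ℝ) ^ (k + 1) * y = m + 1 / 2 := by
      rw [hy]; field_simp
    have hymem : y ∈ Set.Icc (z q.succ) (w q.succ) := by
      constructor
      · refine le_of_mul_le_mul_left (a := (10 : ℝ) ^ (k + 1)) ?_ (by positivity)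
        rw [hy1, hmr, pow_succ]
        linarith
      · refine le_of_mul_le_mul_left (a := (10 : ℝ) ^ (k + 1)) ?_ (by positivity)
        rw [hy1, hmr, pow_succ]
        linarith
    obtain ⟨u, hu, huy⟩ := (hconn.image (fun v : EuclideanSpace ℝ (Fin (e + 2)) => v q.succ)
      (by fun_prop)).Icc_subset ⟨z, hz, rfl⟩ ⟨w, hw, rfl⟩ hymem
    obtain ⟨x', hx', hx0', hxq⟩ := mem_cyclicCarpet_iff.1 (ht hu)
    choose i' hi' hxi' _ hforb using fun k => mem_pattern48x10_iff.1 (hx' k).1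
    simp only at hxi' hforb
    have h00 : u 0 = z 0 := hsub0 ⟨u, hu, rfl⟩ ⟨z, hz, rfl⟩
    rw [h00] at hx0'
    have hdig : (fun k => x k 0) = fun k => x' k 0 :=
      digits_unique (b := 48) (by norm_num) (fun k => by have := hxi k; have := hi k; omega)
        (fun k => by have := hxi' k; have := hi' k; omega) hx0 hx0'
    have hii : i' k = i k := by
      have h1 := congrFun hdig k
      simp only [hxi, hxi'] at h1
      omega
    have huy' : u q.succ = y := huy
    have hdk := digit_eq_mod (b := 10)
      (a := fun k => x' k (Fin.ofNat (e + 1) (k + 1 + q.val)).succ) (by norm_num)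
      (fun k => digitVectors_lt (hx' k) _) (hxq q) (k := k) (m := m)
      (by push_cast; rw [huy', hy1]; linarith) (by push_cast; rw [huy', hy1]; linarith)
    simp only [hkq] at hdk
    refine hforb k ?_
    rw [hii]
    have : (x' k 1 : ℤ) = m % 10 := hdk
    unfold Nat.ModEq
    omega
  intro z hz w hw
  ext p
  refine Fin.cases ?_ (fun q => ?_) p
  · exact hsub0 ⟨z, hz, rfl⟩ ⟨w, hw, rfl⟩
  · exact le_antisymm (hle w hw z hz q) (hle z hz w hw q)

/-! ### Paths meeting the carpet -/

theorem exists_monotone_preimages {g : ℝ → ℝ} {s t : ℝ} (hst : s ≤ t)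
    (hg : ContinuousOn g (Set.Icc s t)) {u : ℕ → ℝ} (hu : Monotone u) (hu0 : u 0 = g s)
    (hut : ∀ i, u i ≤ g t) :
    ∃ τ : ℕ → ℝ, Monotone τ ∧ ∀ i, τ i ∈ Set.Icc s t ∧ g (τ i) = u i := by
  have step : ∀ i (x : {x // x ∈ Set.Icc s t ∧ g x = u i}),
      ∃ y : {y // y ∈ Set.Icc s t ∧ g y = u (i + 1)}, x.1 ≤ y.1 := by
    rintro i ⟨x, hx, hgx⟩
    obtain ⟨y, hy, hgy⟩ := intermediate_value_Icc hx.2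
      (hg.mono (Set.Icc_subset_Icc_left hx.1))
      (show u (i + 1) ∈ Set.Icc (g x) (g t) from ⟨hgx ▸ hu (Nat.le_succ i), hut _⟩)
    exact ⟨⟨y, ⟨hx.1.trans hy.1, hy.2⟩, hgy⟩, hy.1⟩
  choose f hf using step
  let τ : ∀ i, {x // x ∈ Set.Icc s t ∧ g x = u i} := fun i =>
    Nat.rec ⟨s, Set.left_mem_Icc.2 hst, hu0.symm⟩ (fun i x => f i x) i
  exact ⟨fun i => (τ i).1, monotone_nat_of_le_succ fun i => hf i (τ i), fun i => (τ i).2⟩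

/-- One refinement step. While the first coordinate `g` of a path crosses an interval of length
`1 / 48 ^ k`, let the other coordinates `h` have variation at most `1 / 5 / 10 ^ k`. Then the digit
number `k` of `h x q` cannot be `2` for one time `x` and `7` for another, so that one of the two
parities of `i` never meets the digit `5 * i + 7` forbidden over the column `2 * i`. It comprises
`12` columns, and at most `10` of them can carry more than a tenth of the allowed variation; of the
two others at least one misses the given point `p`. -/
theorem exists_good_column {e k : ℕ} {g : ℝ → ℝ} {h : ℝ → Fin (e + 1) → ℝ} {s t : ℝ} (hst : s ≤ t)
    (hg : ContinuousOn g (Set.Icc s t)) (hgt : g t = g s + 1 / 48 ^ k)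
    (hvar : eVariationOn h (Set.Icc s t) ≤ ENNReal.ofReal (1 / 5 / 10 ^ k))
    (q : Fin (e + 1)) (p : ℝ) :
    ∃ i < 24, ∃ s' t', s ≤ s' ∧ s' ≤ t' ∧ t' ≤ t ∧
      g s' = g s + ((2 * i : ℕ) : ℝ) / 48 ^ (k + 1) ∧ g t' = g s' + 1 / 48 ^ (k + 1) ∧
      eVariationOn h (Set.Icc s' t') ≤ ENNReal.ofReal (1 / 5 / 10 ^ (k + 1)) ∧
      p ∉ Set.Icc (g s') (g t') ∧
      ∀ x ∈ Set.Icc s t, ¬ ⌊(10 : ℝ) ^ (k + 1) * h x q⌋ % 10 = (5 * i + 7) % 10 := by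
  obtain ⟨r, hr, hdigit⟩ : ∃ r : ℕ, r < 2 ∧ ∀ x ∈ Set.Icc s t,
      ¬ ⌊(10 : ℝ) ^ (k + 1) * h x q⌋ % 10 = (5 * r + 7) % 10 := by
    by_contra! hcon
    obtain ⟨x, hx, hx'⟩ := hcon 0 (by norm_num)
    obtain ⟨y, hy, hy'⟩ := hcon 1 (by norm_num)
    have hdist : dist (h x q) (h y q) ≤ 1 / 5 / 10 ^ k := by
      have h1 := (eVariationOn.edist_le h hx hy).trans hvar
      rw [edist_dist, ENNReal.ofReal_le_ofReal_iff (by positivity)] at h1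
      exact (dist_le_pi_dist _ _ q).trans h1
    rw [Real.dist_eq] at hdist
    have h2 : |(10 : ℝ) ^ (k + 1) * h x q - 10 ^ (k + 1) * h y q| ≤ 2 := by
      rw [← mul_sub, abs_mul, abs_of_pos (by positivity), pow_succ]
      rw [le_div_iff₀ (by positivity)] at hdist
      linarith
    obtain ⟨h3, h4⟩ := abs_le.1 h2
    have h5 := Int.floor_le ((10 : ℝ) ^ (k + 1) * h x q)
    have h6 := Int.lt_floor_add_one ((10 : ℝ) ^ (k + 1) * h x q)
    have h7 := Int.floor_le ((10 : ℝ) ^ (k + 1) * h y q)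
    have h8 := Int.lt_floor_add_one ((10 : ℝ) ^ (k + 1) * h y q)
    set m := ⌊(10 : ℝ) ^ (k + 1) * h x q⌋
    set m' := ⌊(10 : ℝ) ^ (k + 1) * h y q⌋
    have h9 : m < m' + 4 := by
      have : (m : ℝ) < m' + 4 := by linarith
      exact_mod_cast this
    have h10 : m' < m + 4 := by
      have : (m' : ℝ) < m + 4 := by linarith
      exact_mod_cast this
    omega
  have hp48 : (0 : ℝ) < 48 ^ (k + 1) := by positivity
  obtain ⟨τ, hτ, hτg⟩ := exists_monotone_preimages hst hg
    (u := fun i => g s + ((min i 48 : ℕ) : ℝ) / 48 ^ (k + 1))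
    (fun i j hij => by
      have : ((min i 48 : ℕ) : ℝ) ≤ ((min j 48 : ℕ) : ℝ) := by
        exact_mod_cast min_le_min_right 48 hij
      simp only
      gcongr) (by simp)
    (fun i => by
      have : ((min i 48 : ℕ) : ℝ) ≤ 48 := by exact_mod_cast min_le_right i 48
      rw [hgt, pow_succ]
      have : ((min i 48 : ℕ) : ℝ) / (48 ^ k * 48) ≤ 1 / 48 ^ k := by
        rw [div_le_div_iff₀ (by positivity) (by positivity)]
        have : (0 : ℝ) < 48 ^ k := by positivity
        nlinarith
      linarith)
  have hτle : ∀ i ≤ 48, g (τ i) = g s + (i : ℝ) / 48 ^ (k + 1) := fun i hi => by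
    rw [(hτg i).2, min_eq_left hi]
  set c := ENNReal.ofReal (1 / 5 / 10 ^ (k + 1)) with hc
  have hc0 : c ≠ 0 := by
    rw [hc, Ne, ENNReal.ofReal_eq_zero, not_le]; positivity
  have hctop : c ≠ ⊤ := ENNReal.ofReal_ne_top
  have hc10 : ENNReal.ofReal (1 / 5 / 10 ^ k) = 10 * c := by
    rw [hc, show (10 : ENNReal) = ENNReal.ofReal 10 by simp, ← ENNReal.ofReal_mul (by norm_num)]
    congr 1
    rw [pow_succ]
    field_simp
  let v : ℕ → ENNReal := fun j =>
    eVariationOn h (Set.Icc (τ (4 * j + 2 * r)) (τ (4 * j + 2 * r + 1)))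
  have hsum : ∑ j ∈ Finset.range 12, v j ≤ 10 * c := by
    have h1 := eVariationOn.sum' h (I := fun j => τ (4 * j + 2 * r))
      (fun i j hij => hτ (by omega)) (n := 12)
    rw [← hc10]
    refine le_trans ?_ hvar
    refine le_trans (Finset.sum_le_sum fun j _ => ?_)
      (h1.le.trans (eVariationOn.mono h (Set.Icc_subset_Icc (hτg _).1.1 (hτg _).1.2)))
    exact eVariationOn.mono h (Set.Icc_subset_Icc le_rfl (hτ (by omega)))
  have hcard : 1 < ((Finset.range 12).filter fun j => v j ≤ c).card := by
    have h1 := Finset.card_filter_add_card_filter_not (s := Finset.range 12) (fun j => v j ≤ c)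
    rw [Finset.card_range] at h1
    have h2 : ((Finset.range 12).filter fun j => ¬ v j ≤ c).card ≤ 10 := by
      have h3 : (((Finset.range 12).filter fun j => ¬ v j ≤ c).card : ENNReal) * c ≤ 10 * c := by
        rw [← nsmul_eq_mul]
        refine (Finset.card_nsmul_le_sum _ v c fun j hj => ?_).trans
          ((Finset.sum_le_sum_of_subset (Finset.filter_subset _ _)).trans hsum)
        exact (not_le.1 (Finset.mem_filter.1 hj).2).le
      rw [ENNReal.mul_le_mul_iff_left hc0 hctop] at h3
      exact_mod_cast h3
    omega
  have hcol : ∀ j < 12, g (τ (4 * j + 2 * r)) = g s + ((2 * (2 * j + r) : ℕ) : ℝ) / 48 ^ (k + 1) ∧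
      g (τ (4 * j + 2 * r + 1)) = g (τ (4 * j + 2 * r)) + 1 / 48 ^ (k + 1) := by
    intro j hj
    rw [hτle _ (by omega), hτle _ (by omega)]
    constructor
    · congr 3; omega
    · push_cast; ring
  obtain ⟨j, hj, hvj, hpj⟩ : ∃ j < 12, v j ≤ c ∧
      p ∉ Set.Icc (g (τ (4 * j + 2 * r))) (g (τ (4 * j + 2 * r + 1))) := by
    obtain ⟨j, hj, j', hj', hne⟩ := Finset.one_lt_card.1 hcard
    simp only [Finset.mem_filter, Finset.mem_range] at hj hj'
    by_contra! hcon
    have key : ∀ j j', j < 12 → j' < 12 → v j ≤ c → v j' ≤ c → ¬ j < j' := by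
      intro j j' hj hj' hv hv' hlt
      have h1 := (hcon j hj hv).2
      have h2 := (hcon j' hj' hv').1
      rw [(hcol j hj).2, (hcol j hj).1] at h1
      rw [(hcol j' hj').1] at h2
      have h3 : ((2 * (2 * j' + r) : ℕ) : ℝ) / 48 ^ (k + 1) ≤
          ((2 * (2 * j + r) + 1 : ℕ) : ℝ) / 48 ^ (k + 1) := by
        push_cast at h1 h2 ⊢
        rw [add_div]
        linarith
      rw [div_le_div_iff_of_pos_right hp48] at h3
      have : 2 * (2 * j' + r) ≤ 2 * (2 * j + r) + 1 := by exact_mod_cast h3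
      omega
    rcases lt_or_gt_of_ne hne with hlt | hlt
    · exact key _ _ hj.1 hj'.1 hj.2 hj'.2 hlt
    · exact key _ _ hj'.1 hj.1 hj'.2 hj.2 hlt
  refine ⟨2 * j + r, by omega, τ (4 * j + 2 * r), τ (4 * j + 2 * r + 1), (hτg _).1.1,
    hτ (by omega), (hτg _).1.2, (hcol j hj).1, (hcol j hj).2, hvj, hpj, fun x hx hcon => ?_⟩
  refine hdigit x hx (hcon.trans ?_)
  push_cast
  omega

/-- Iterating the refinement step, with the columns chosen to avoid the numbers `p n` one after the
other, yields nested time intervals whose left end points converge to a time at which the path is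
in the carpet. -/
theorem exists_mem_cyclicCarpet {e : ℕ} {g : ℝ → ℝ} {h : ℝ → Fin (e + 1) → ℝ} {a b : ℝ}
    (hab : a ≤ b) (hg : ContinuousOn g (Set.Icc a b)) (hga : g a = 0) (hgb : g b = 1)
    (hha : ∀ q, h a q = 1 / 2) (hvar : eVariationOn h (Set.Icc a b) ≤ ENNReal.ofReal (1 / 5))
    (p : ℕ → ℝ) :
    ∃ x ∈ Set.Icc a b, (WithLp.toLp 2 (Fin.cons (g x) (h x)) : EuclideanSpace ℝ (Fin (e + 2))) ∈
      cyclicCarpet e ∧ ∀ n, g x ≠ p n := by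
  -- the coordinate constrained by the pattern at level `k`
  let q : ℕ → Fin (e + 1) := fun k => 0 - Fin.ofNat (e + 1) (k + 1)
  let State : ℕ → Type := fun k => {w : ℝ × ℝ // a ≤ w.1 ∧ w.1 ≤ w.2 ∧ w.2 ≤ b ∧
    g w.2 = g w.1 + 1 / 48 ^ k ∧
    eVariationOn h (Set.Icc w.1 w.2) ≤ ENNReal.ofReal (1 / 5 / 10 ^ k)}
  have step : ∀ k (w : State k), ∃ w' : State (k + 1), ∃ i < 24, w.1.1 ≤ w'.1.1 ∧
      w'.1.2 ≤ w.1.2 ∧ g w'.1.1 = g w.1.1 + ((2 * i : ℕ) : ℝ) / 48 ^ (k + 1) ∧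
      p k ∉ Set.Icc (g w'.1.1) (g w'.1.2) ∧
      ∀ x ∈ Set.Icc w.1.1 w.1.2,
        ¬ ⌊(10 : ℝ) ^ (k + 1) * h x (q k)⌋ % 10 = (5 * i + 7) % 10 := by
    rintro k ⟨⟨s, t⟩, hs, hst, ht, hgt, hv⟩
    obtain ⟨i, hi, s', t', h1, h2, h3, h4, h5, h6, h7, h8⟩ := exists_good_column hst
      (hg.mono (Set.Icc_subset_Icc hs ht)) hgt hv (q k) (p k)
    exact ⟨⟨(s', t'), hs.trans h1, h2, h3.trans ht, h5, h6⟩, i, hi, h1, h3, h4, h7, h8⟩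
  choose f i hi hfs hft hfg hfp hfd using step
  let S : ∀ k, State k := fun k =>
    Nat.rec ⟨(a, b), le_rfl, hab, le_rfl, by simp [hga, hgb], by simpa using hvar⟩
      (fun k w => f k w) k
  let s : ℕ → ℝ := fun k => (S k).1.1
  let t : ℕ → ℝ := fun k => (S k).1.2
  let d : ℕ → ℕ := fun k => i k (S k)
  have hd : ∀ k, d k < 24 := fun k => hi k (S k)
  have hs : Monotone s := monotone_nat_of_le_succ fun k => hfs k (S k)
  have ht : Antitone t := antitone_nat_of_succ_le fun k => hft k (S k)
  have hst : ∀ k, s k ≤ t k := fun k => (S k).2.2.1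
  have hst' : ∀ k j, s k ≤ t j := fun k j =>
    (hs (le_max_left k j)).trans ((hst _).trans (ht (le_max_right k j)))
  have hgs : ∀ k, g (s (k + 1)) = g (s k) + ((2 * d k : ℕ) : ℝ) / 48 ^ (k + 1) :=
    fun k => hfg k (S k)
  have hgt : ∀ k, g (t k) = g (s k) + 1 / 48 ^ k := fun k => (S k).2.2.2.2.1
  have hbdd : BddAbove (Set.range s) := ⟨t 0, by rintro _ ⟨k, rfl⟩; exact hst' k 0⟩
  let x : ℝ := ⨆ k, s k
  have hsx : ∀ k, s k ≤ x := fun k => le_ciSup hbdd k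
  have hxt : ∀ k, x ≤ t k := fun k => ciSup_le fun j => hst' j k
  have hx : x ∈ Set.Icc a b := ⟨hsx 0, hxt 0⟩
  have hlim : Filter.Tendsto (fun k => g (s k)) Filter.atTop (nhds (g x)) := by
    refine (hg x hx).tendsto.comp (tendsto_nhdsWithin_iff.2
      ⟨tendsto_atTop_ciSup hs hbdd, Filter.Eventually.of_forall fun k => ?_⟩)
    exact ⟨hs (Nat.zero_le k), (hst k).trans (ht (Nat.zero_le k))⟩
  have hgmono : Monotone fun k => g (s k) := monotone_nat_of_le_succ fun k => by
    rw [hgs]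
    have : (0 : ℝ) ≤ ((2 * d k : ℕ) : ℝ) / 48 ^ (k + 1) := by positivity
    linarith
  have hganti : Antitone fun k => g (t k) := antitone_nat_of_succ_le fun k => by
    rw [hgt (k + 1), hgt k, hgs, pow_succ]
    have h1 : ((2 * d k : ℕ) : ℝ) ≤ 46 := by
      have := hd k
      exact_mod_cast (by omega : 2 * d k ≤ 46)
    have h2 : ((2 * d k : ℕ) : ℝ) / (48 ^ k * 48) + 1 / (48 ^ k * 48) ≤ 1 / 48 ^ k := by
      rw [← add_div, div_le_div_iff₀ (by positivity) (by positivity)]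
      have : (0 : ℝ) < 48 ^ k := by positivity
      nlinarith
    linarith
  have hpartial : ∀ k, ∑ j ∈ Finset.range k, ((2 * d j : ℕ) : ℝ) / 48 ^ (j + 1) = g (s k) := by
    intro k
    induction k with
    | zero => exact hga.symm
    | succ k ih => rw [Finset.sum_range_succ, ih, hgs]
  have hrange : ∀ q, h x q ∈ Set.Ico (0 : ℝ) 1 := by
    intro q
    have h1 := (eVariationOn.edist_le h hx (Set.left_mem_Icc.2 hab)).trans hvar
    rw [edist_dist, ENNReal.ofReal_le_ofReal_iff (by positivity)] at h1
    have h2 := (dist_le_pi_dist _ _ q).trans h1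
    rw [Real.dist_eq, hha, abs_le] at h2
    constructor <;> linarith
  refine ⟨x, hx, mem_cyclicCarpet_iff.2
    ⟨fun k => Fin.cons (2 * d k)
      (fun p => (Real.digits (h x (p - Fin.ofNat (e + 1) (k + 1))) 10 k : ℕ)), fun k => ?_, ?_,
      fun q' => ?_⟩, fun n hn => ?_⟩
  · refine ⟨⟨d k, Real.digits (h x (q k)) 10 k, hd k, Fin.is_lt _, fun hmod => ?_, rfl⟩,
      fun p hp => ?_⟩
    · refine hfd k (S k) x ⟨hsx k, hxt k⟩ ?_
      have h1 : (Real.digits (h x (q k)) 10 k : ℕ) = ⌊(10 : ℝ) ^ (k + 1) * h x (q k)⌋₊ % 10 := by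
        simp [Real.digits, Fin.ofNat, mul_comm]
      rw [h1] at hmod
      have h2 : ((⌊(10 : ℝ) ^ (k + 1) * h x (q k)⌋₊ : ℕ) : ℤ) =
          ⌊(10 : ℝ) ^ (k + 1) * h x (q k)⌋ :=
        Int.natCast_floor_eq_floor (mul_nonneg (by positivity) (hrange _).1)
      rw [← h2]
      unfold Nat.ModEq at hmod
      show _ = (5 * (d k : ℤ) + 7) % 10
      omega
    · obtain ⟨p', rfl⟩ := Fin.exists_succ_eq.2 (show p ≠ 0 by rintro rfl; simp at hp)
      exact Fin.is_lt _
  · refine (hasSum_iff_tendsto_nat_of_nonneg (fun k => by positivity) _).2 ?_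
    refine hlim.congr fun k => ?_
    rw [← hpartial]
    rfl
  · have h1 := Real.hasSum_ofDigitsTerm_digits (h x q') (b := 10) (by norm_num) (hrange q')
    have h2 : ∀ k : ℕ, Fin.ofNat (e + 1) (k + 1 + q'.val) - Fin.ofNat (e + 1) (k + 1) = q' := by
      intro k
      rw [sub_eq_iff_eq_add]
      ext
      simp [Fin.val_add, add_comm]
    simp only [Fin.cons_succ, h2, div_eq_mul_inv]
    exact h1
  · refine hfp n (S n) ?_
    rw [← hn]
    exact ⟨hgmono.ge_of_tendsto hlim (n + 1), le_of_tendsto hlim (Filter.eventually_atTop.2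
      ⟨n + 1, fun k hk => le_trans (by
        show g (s k) ≤ g (t k)
        rw [hgt]
        have : (0 : ℝ) < 1 / 48 ^ k := by positivity
        linarith) (hganti hk)⟩)⟩

/-- A path whose first coordinate `g` runs from `0` to `1`, and whose length exceeds `1` by at most
`1 / 100`, has little variation in the other coordinates `h` if the norm dominates
`24 / 25 * |g| + 7 / 25 * ‖h‖`: the first summand alone uses up a length of `24 / 25`, which leaves
`1 / 20 = 7 / 25 * (5 / 28)` for the second. -/
theorem eVariationOn_transversal_le {E F : Type*} [NormedAddCommGroup E] [NormedAddCommGroup F]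
    {γ : ℝ → E} {g : ℝ → ℝ} {h : ℝ → F} {a b : ℝ} (hga : g a = 0) (hgb : g b = 1)
    (hnorm : ∀ s t, 24 / 25 * |g s - g t| + 7 / 25 * ‖h s - h t‖ ≤ ‖γ s - γ t‖)
    (hlen : eVariationOn γ (Set.Icc a b) ≤ ENNReal.ofReal (1 + 1 / 100)) :
    eVariationOn h (Set.Icc a b) ≤ ENNReal.ofReal (1 / 5) := by
  refine iSup_le fun w => ?_
  obtain ⟨n, u, hu, hmem⟩ := w
  -- the partition `u` enlarged by the end points `a` and `b`
  let v : ℕ → ℝ := fun i => Nat.casesOn i a fun i => if i ≤ n then u i else b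
  have hv0 : v 0 = a := rfl
  have hvs : ∀ i ≤ n, v (i + 1) = u i := fun i hi => if_pos hi
  have hvn : v (n + 2) = b := if_neg (by omega)
  have hvmem : ∀ i, v i ∈ Set.Icc a b := by
    have hab : a ≤ b := (hmem 0).1.trans (hmem 0).2
    rintro (_ | i)
    · exact ⟨le_rfl, hab⟩
    · by_cases hi : i ≤ n
      · rw [hvs i hi]; exact hmem i
      · rw [show v (i + 1) = b from if_neg hi]; exact ⟨hab, le_rfl⟩
  have hv : Monotone v := monotone_nat_of_le_succ fun i => by
    rcases i with _ | i
    · exact (hvmem 1).1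
    · by_cases hi : i + 1 ≤ n
      · rw [hvs i (by omega), hvs _ hi]; exact hu (Nat.le_succ i)
      · rw [show v (i + 1 + 1) = b from if_neg hi]; exact (hvmem (i + 1)).2
  have h1 : ∑ i ∈ Finset.range (n + 2), ‖γ (v (i + 1)) - γ (v i)‖ ≤ 1 + 1 / 100 := by
    have h2 := (eVariationOn.sum_le (f := γ) hv hvmem (n := n + 2)).trans hlen
    simp only [edist_dist, dist_eq_norm] at h2
    rwa [← ENNReal.ofReal_sum_of_nonneg fun _ _ => norm_nonneg _,
      ENNReal.ofReal_le_ofReal_iff (by norm_num)] at h2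
  have h3 : ∑ i ∈ Finset.range (n + 2), (g (v (i + 1)) - g (v i)) = 1 := by
    rw [Finset.sum_range_sub (fun i => g (v i)), hvn, hv0, hga, hgb, sub_zero]
  have h4 : ∑ i ∈ Finset.range (n + 2), (24 / 25 * (g (v (i + 1)) - g (v i)) +
      7 / 25 * ‖h (v (i + 1)) - h (v i)‖) ≤ 1 + 1 / 100 :=
    (Finset.sum_le_sum fun i _ => (add_le_add_left (mul_le_mul_of_nonneg_left (le_abs_self _)
      (by norm_num)) _).trans (hnorm _ _)).trans h1
  rw [Finset.sum_add_distrib, ← Finset.mul_sum, ← Finset.mul_sum, h3] at h4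
  have h5 : ∑ i ∈ Finset.range n, ‖h (u (i + 1)) - h (u i)‖ ≤
      ∑ i ∈ Finset.range (n + 2), ‖h (v (i + 1)) - h (v i)‖ := by
    rw [Finset.sum_range_succ, Finset.sum_range_succ']
    have h6 : ∑ i ∈ Finset.range n, ‖h (v (i + 1 + 1)) - h (v (i + 1))‖ =
        ∑ i ∈ Finset.range n, ‖h (u (i + 1)) - h (u i)‖ := by
      refine Finset.sum_congr rfl fun i hi => ?_
      rw [Finset.mem_range] at hi
      rw [hvs (i + 1) hi, hvs i hi.le]
    rw [h6]
    have := norm_nonneg (h (v (0 + 1)) - h (v 0))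
    have := norm_nonneg (h (v (n + 1 + 1)) - h (v (n + 1)))
    linarith
  simp only [edist_dist, dist_eq_norm]
  rw [← ENNReal.ofReal_sum_of_nonneg fun _ _ => norm_nonneg _]
  refine ENNReal.ofReal_le_ofReal ?_
  linarith

/-- The proof joins `(0, 1/2, …, 1/2)` to `(1, 1/2, …, 1/2)`. Whatever countable set of first
coordinates is given, the path meets the carpet at a point whose first coordinate is not in it, so
the first coordinates of the common points form an uncountable set. -/
theorem impermeable_cyclicCarpet_of_norm {e : ℕ} {r : ENNReal} [Fact (1 ≤ r)]
    (hnorm : ∀ (v : PiLp r (fun _ : Fin (e + 2) => ℝ)) (q : Fin (e + 1)),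
      24 / 25 * |v 0| + 7 / 25 * |v q.succ| ≤ ‖v‖) :
    Impermeable {x : PiLp r (fun _ : Fin (e + 2) => ℝ) |
      (WithLp.toLp 2 (fun i => x i) : EuclideanSpace ℝ (Fin (e + 2))) ∈ cyclicCarpet e} := by
  intro hperm
  set x : PiLp r (fun _ : Fin (e + 2) => ℝ) := WithLp.toLp r (Fin.cons 0 fun _ => 1 / 2)
  have hxy : ‖x + PiLp.single r 0 1 - x‖ = 1 := by
    rw [add_sub_cancel_left]
    simp
  obtain ⟨a, b, γ, hab, hγ, hγa, hγb, hlen, hcount⟩ :=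
    hperm x (x + PiLp.single r 0 1) (1 / 100) (by norm_num)
  rw [hxy] at hlen
  have hcoord : ∀ i, ContinuousOn (fun t => γ t i) (Set.Icc a b) := fun i =>
    (PiLp.continuous_apply r _ i).comp_continuousOn hγ
  have hga : γ a 0 = 0 := by rw [hγa]; rfl
  have hgb : γ b 0 = 1 := by rw [hγb]; simp [x]
  have hvar := eVariationOn_transversal_le (γ := γ) (g := fun t => γ t 0)
    (h := fun t (q : Fin (e + 1)) => γ t q.succ) hga hgb (fun s t => by
      have h1 : ‖(fun q : Fin (e + 1) => γ s q.succ) - fun q => γ t q.succ‖ ≤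
          25 / 7 * (‖γ s - γ t‖ - 24 / 25 * |γ s 0 - γ t 0|) := by
        have h2 := fun q => hnorm (γ s - γ t) q
        simp only [PiLp.sub_apply] at h2
        refine (pi_norm_le_iff_of_nonneg ?_).2 fun q => ?_
        · have := h2 0
          have := abs_nonneg (γ s (Fin.succ 0) - γ t (Fin.succ 0))
          linarith
        · rw [Pi.sub_apply, Real.norm_eq_abs]
          linarith [h2 q]
      linarith) hlen
  have himage : ((fun z : PiLp r (fun _ : Fin (e + 2) => ℝ) => z 0) '' closure (γ '' Set.Icc a b ∩
      {x | (WithLp.toLp 2 (fun i => x i) : EuclideanSpace ℝ (Fin (e + 2))) ∈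
        cyclicCarpet e})).Countable := hcount.image _
  have key : ∀ p : ℕ → ℝ, ∃ c ∈ (fun z : PiLp r (fun _ : Fin (e + 2) => ℝ) => z 0) ''
      closure (γ '' Set.Icc a b ∩ {x | (WithLp.toLp 2 (fun i => x i) :
        EuclideanSpace ℝ (Fin (e + 2))) ∈ cyclicCarpet e}), ∀ n, c ≠ p n := by
    intro p
    obtain ⟨t, ht, hmem, hne⟩ := exists_mem_cyclicCarpet hab.le (hcoord 0) hga hgb
      (fun q => by rw [hγa]; rfl) hvar p
    refine ⟨γ t 0, ⟨γ t, subset_closure ⟨⟨t, ht, rfl⟩, ?_⟩, rfl⟩, hne⟩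
    have heq : (Fin.cons (γ t 0) fun q : Fin (e + 1) => γ t q.succ) = fun i => γ t i := by
      ext i
      refine Fin.cases rfl (fun q => rfl) i
    rwa [heq] at hmem
  obtain ⟨c, hc, -⟩ := key 0
  obtain ⟨p, hp⟩ := himage.exists_eq_range ⟨c, hc⟩
  obtain ⟨c', hc', hne⟩ := key p
  rw [hp] at hc'
  obtain ⟨n, rfl⟩ := hc'
  exact hne n rfl

theorem EuclideanSpace.slanted_le_norm {e : ℕ} (v : EuclideanSpace ℝ (Fin (e + 2)))
    (q : Fin (e + 1)) : 24 / 25 * |v 0| + 7 / 25 * |v q.succ| ≤ ‖v‖ := by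
  have h1 : |v 0| ^ 2 + |v q.succ| ^ 2 ≤ ‖v‖ ^ 2 := by
    rw [EuclideanSpace.norm_sq_eq, Fin.sum_univ_succ]
    simp only [Real.norm_eq_abs]
    gcongr
    exact Finset.single_le_sum (f := fun q : Fin (e + 1) => |v q.succ| ^ 2)
      (fun _ _ => sq_nonneg _) (Finset.mem_univ q)
  -- Cauchy-Schwarz with the unit vector `(24 / 25, 7 / 25)`
  refine abs_le_of_sq_le_sq' ?_ (norm_nonneg v) |>.2
  nlinarith [sq_nonneg (7 * |v 0| - 24 * |v q.succ|)]

theorem PiLp.slanted_le_one_norm {e : ℕ} (v : PiLp 1 (fun _ : Fin (e + 2) => ℝ))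
    (q : Fin (e + 1)) : 24 / 25 * |v 0| + 7 / 25 * |v q.succ| ≤ ‖v‖ := by
  rw [PiLp.norm_eq_of_L1, Fin.sum_univ_succ]
  simp only [Real.norm_eq_abs]
  have h1 := Finset.single_le_sum (f := fun q : Fin (e + 1) => |v q.succ|)
    (fun _ _ => abs_nonneg _) (Finset.mem_univ q)
  have h2 := abs_nonneg (v 0)
  have h3 := abs_nonneg (v q.succ)
  simp only at h1
  linarith

theorem nonempty_cyclicCarpet (e : ℕ) : (cyclicCarpet e).Nonempty := by
  refine ⟨0, mem_cyclicCarpet_iff.2 ⟨fun _ _ => 0, fun k => ⟨⟨0, 0, by norm_num, by norm_num,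
    by decide, rfl⟩, fun _ _ => by norm_num⟩, ?_, fun q => ?_⟩⟩ <;> simp

/-! ### The Cantor set on the line -/

/-- A path from a point with `c = 0` to a point with `c = 1` meets every fibre of `c` over `[0, 1]`,
hence meets uncountably many points of `Θ` as soon as `Θ` contains uncountably many fibres. -/
theorem impermeable_of_coord {E : Type*} [NormedAddCommGroup E] {c : E → ℝ} (hc : Continuous c)
    {Θ : Set E} {N : Set ℝ} (hN : ¬ N.Countable) (hN' : N ⊆ Set.Icc 0 1)
    (hΘ : ∀ z, c z ∈ N → z ∈ Θ) {x y : E} (hx : c x = 0) (hy : c y = 1) : Impermeable Θ := by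
  intro hperm
  obtain ⟨a, b, γ, hab, hγ, rfl, rfl, -, hcount⟩ := hperm x y 1 one_pos
  refine hN ((hcount.image c).mono fun r hr => ?_)
  obtain ⟨t, ht, rfl⟩ := intermediate_value_Icc hab.le (hc.comp_continuousOn hγ)
    (show r ∈ Set.Icc ((c ∘ γ) a) ((c ∘ γ) b) by
      simp only [Function.comp_apply, hx, hy]; exact hN' hr)
  exact ⟨γ t, subset_closure ⟨⟨t, ht, rfl⟩, hΘ _ hr⟩, rfl⟩

theorem not_countable_cantorSet : ¬ cantorSet.Countable := by
  intro h
  have := h.to_subtype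
  have h2 : Countable (ℕ → Bool) := cantorSetEquivNatToBool.symm.injective.countable
  obtain ⟨f, hf⟩ := exists_surjective_nat (ℕ → Bool)
  obtain ⟨n, hn⟩ := hf fun n => !(f n n)
  simpa using congrFun hn n

theorem carpetExample_one : carpetExample 1 = {z | z 0 ∈ cantorSet} := rfl

theorem isCompact_carpetExample_one : IsCompact (carpetExample 1) := by
  have h1 : carpetExample 1 =
      (fun r : ℝ => (WithLp.toLp 2 fun _ => r : EuclideanSpace ℝ (Fin 1))) '' cantorSet := by
    rw [carpetExample_one]
    ext z
    constructor
    · intro hz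
      refine ⟨z 0, hz, ?_⟩
      ext i
      rw [Fin.fin_one_eq_zero i]
    · rintro ⟨r, hr, rfl⟩
      exact hr
  rw [h1]
  exact isCompact_cantorSet.image
    ((PiLp.continuous_toLp 2 _).comp (continuous_pi fun _ => continuous_id))

theorem isTotallyDisconnected_carpetExample_one : IsTotallyDisconnected (carpetExample 1) := by
  intro t ht hconn z hz w hw
  have h1 := IsPreconnected.subsingleton_of_volume_eq_zero volume_cantorSet
    (t := (fun z : EuclideanSpace ℝ (Fin 1) => z 0) '' t)
    (by rintro _ ⟨z, hz, rfl⟩; exact ht hz) (hconn.image _ (by fun_prop))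
  ext i
  rw [Fin.fin_one_eq_zero i]
  exact h1 ⟨z, hz, rfl⟩ ⟨w, hw, rfl⟩

/-! ### Conclusion -/

theorem mainTheorem10 :
    (∀ d : ℕ, 1 ≤ d → ∃ Θ : Set (EuclideanSpace ℝ (Fin d)),
      Impermeable Θ ∧ IsCompact Θ ∧ MeasureTheory.volume Θ = 0 ∧
        smallInductiveDimension Θ = 0 ∧
        Θ = carpetExample d ∧ Impermeable (inOneNorm Θ)) ∧
    carpetExample 2 = bedfordMcMullenCarpet 48 10 pattern48x10 := by
  refine ⟨fun d hd => ⟨carpetExample d, ?_⟩, cyclicCarpet_zero_eq⟩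
  match d, hd with
  | 1, _ =>
    refine ⟨impermeable_of_coord (c := fun z => z 0) (by fun_prop) not_countable_cantorSet
        cantorSet_subset_unitInterval (fun z hz => hz) (x := 0)
        (y := WithLp.toLp 2 fun _ => 1) rfl rfl,
      isCompact_carpetExample_one,
      EuclideanSpace.volume_eq_zero_of_coord 0 volume_cantorSet fun z hz => hz,
      smallInductiveDimension_eq_zero isCompact_carpetExample_one ⟨0, zero_mem_cantorSet⟩
        isTotallyDisconnected_carpetExample_one, rfl,
      impermeable_of_coord (c := fun z => z 0) (by fun_prop) not_countable_cantorSet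
        cantorSet_subset_unitInterval (fun z hz => hz) (x := 0)
        (y := WithLp.toLp 1 fun _ => 1) rfl rfl⟩
  | e + 2, _ =>
    exact ⟨impermeable_cyclicCarpet_of_norm EuclideanSpace.slanted_le_norm,
      isCompact_cyclicCarpet e,
      EuclideanSpace.volume_eq_zero_of_coord 0 volume_evenDigitSet
        fun z hz => coord_zero_mem_evenDigitSet hz,
      smallInductiveDimension_eq_zero (isCompact_cyclicCarpet e) (nonempty_cyclicCarpet e)
        (isTotallyDisconnected_cyclicCarpet e), rfl,
      impermeable_cyclicCarpet_of_norm PiLp.slanted_le_one_norm⟩
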